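/- Let $\mathcal H$ be an infinite-dimensional separable real Hilbert space with orthonormal basis $(e_k)_{k\in\mathbb N}$, let $V=\{e_0\}^{\perp}$, and let $K$ be the smallest closed convex cone containing the set $$\Big\{e^{-100\xi^3}e_0+\cos\big(\tfrac{\pi}{2}(\xi-\lfloor\xi\rfloor)\big)\,e_{\lfloor\xi\rfloor+1}+\sin\big(\tfrac{\pi}{2}(\xi-\lfloor\xi\rfloor)\big)\,e_{\lfloor\xi\rfloor+2}\;:\;\xi\in[0,+\infty)\Big\}.$$ Let $\mathrm{proj}_C$ denote the projection operator onto a nonempty closed convex set $C$. For a set-valued operator $A\colon\mathcal H\to 2^{\mathcal H}$, let $A^{-1}u=\{x : u\in Ax\}$ and let $J_A=(\mathrm{Id}+A)^{-1}$ be its resolvent. Set $$B=(\mathrm{proj}_V\circ\mathrm{proj}_K\circ\mathrm{proj}_V)^{-1}-\mathrm{Id}.$$ Then $B$ is maximally monotone, $J_B$ and $J_{B^{-1}}$ are single-valued with full domain, and $(x,u)=(0,0)$ solves the problem $$\text{find } x\in V \text{ and } u\in V^{\perp} \text{ such that } u\in Bx .$$ Let $(x_n,u_n)_{n\in\mathbb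 N}$ be the sequence generated by Spingarn's method of partial inverses from $x_0=e_2\in V$ and $u_0=0\in V^\perp$, that is, $$x_{n+1}=\mathrm{proj}_V\big(J_B(x_n+u_n)\big),\qquad u_{n+1}=\mathrm{proj}_{V^{\perp}}\big(J_{B^{-1}}(x_n+u_n)\big)\qquad(n\in\mathbb N),$$ and let $z_0=e_2$ and $z_{n+1}=\mathrm{proj}_K(\mathrm{proj}_V z_n)$ for $n\in\mathbb N$. Then $u_n=0$ and $x_n=\mathrm{proj}_V z_n$ for every $n\in\mathbb N$, and $(x_n,u_n)_{n\in\mathbb N}$ converges weakly but not strongly to $(0,0)$ in $\mathcal H\oplus\mathcal H$. -/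

import Mathlib

open Filter Topology
open scoped Pointwise InnerProductSpace

noncomputable section

namespace Splitting

section SetValued

variable {H : Type*} [NormedAddCommGroup H] [InnerProductSpace ℝ H]

/-- The inverse of a set-valued operator: `x ∈ A⁻¹ u` iff `u ∈ A x`. -/
def inverse (A : H → Set H) : H → Set H := fun u => {x | u ∈ A x}

/-- The resolvent `J_A = (Id + A)⁻¹`, as a set-valued operator. -/
def resolvent (A : H → Set H) : H → Set H := inverse (fun x => {x} + A x)

/-- The operator `T⁻¹ - Id`, where the map `T` is regarded as the set-valued operator
`x ↦ {T x}`. -/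
def inverseSubId (T : H → H) : H → Set H := fun x => inverse (fun y => {T y}) x - {x}

/-- Monotonicity of a set-valued operator. -/
def IsMonotone (A : H → Set H) : Prop :=
  ∀ x y : H, ∀ u ∈ A x, ∀ v ∈ A y, 0 ≤ ⟪x - y, u - v⟫_ℝ

/-- Maximal monotonicity: `A` is monotone and no monotone operator has a graph that properly
contains the graph of `A`. -/
def IsMaximallyMonotone (A : H → Set H) : Prop :=
  IsMonotone A ∧ ∀ A' : H → Set H, IsMonotone A' → (∀ x, A x ⊆ A' x) → A' = A

/-- `p` is a point of `C` at minimal distance from `x`. -/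
def IsNearestPoint (C : Set H) (x p : H) : Prop :=
  p ∈ C ∧ ∀ q ∈ C, ‖x - p‖ ≤ ‖x - q‖

open Classical in
/-- The projection operator onto `C`. It is the genuine one on nonempty closed convex sets, see
`projOnto_eq_iff`; where no nearest point exists it takes the value `0`. -/
def projOnto (C : Set H) (x : H) : H :=
  if h : ∃ p, IsNearestPoint C x p then h.choose else 0

theorem existsUnique_isNearestPoint [CompleteSpace H] {C : Set H} (hne : C.Nonempty)
    (hcl : IsClosed C) (hcv : Convex ℝ C) (x : H) : ∃! p, IsNearestPoint C x p := by
  have key : ∀ p ∈ C, (∀ q ∈ C, ‖x - p‖ ≤ ‖x - q‖) → ∀ w ∈ C, ⟪x - p, w - p⟫_ℝ ≤ 0 := by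
    intro p hp hmin
    have : Nonempty C := ⟨⟨p, hp⟩⟩
    refine (norm_eq_iInf_iff_real_inner_le_zero hcv hp).1 (le_antisymm ?_ ?_)
    · exact le_ciInf fun w => hmin w w.2
    · exact ciInf_le (f := fun w : C => ‖x - w‖)
        ⟨0, Set.forall_mem_range.2 fun _ => norm_nonneg _⟩ ⟨p, hp⟩
  obtain ⟨p, hp, hpe⟩ := exists_norm_eq_iInf_of_complete_convex hne hcl.isComplete hcv x
  have hpmin : ∀ q ∈ C, ‖x - p‖ ≤ ‖x - q‖ := fun q hq => by
    rw [hpe]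
    exact ciInf_le (f := fun w : C => ‖x - w‖)
      ⟨0, Set.forall_mem_range.2 fun _ => norm_nonneg _⟩ ⟨q, hq⟩
  refine ⟨p, ⟨hp, hpmin⟩, ?_⟩
  rintro q ⟨hq, hqmin⟩
  have h1 := key p hp hpmin q hq
  have h2 := key q hq hqmin p hp
  have h3 : ⟪q - p, q - p⟫_ℝ = ⟪x - p, q - p⟫_ℝ + ⟪x - q, p - q⟫_ℝ := by
    simp only [inner_sub_left, inner_sub_right]
    ring
  have h4 : ⟪q - p, q - p⟫_ℝ = 0 := le_antisymm (by linarith) real_inner_self_nonneg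
  exact sub_eq_zero.1 (inner_self_eq_zero.1 h4)

theorem projOnto_eq_iff [CompleteSpace H] {C : Set H} (hne : C.Nonempty)
    (hcl : IsClosed C) (hcv : Convex ℝ C) (x p : H) :
    projOnto C x = p ↔ IsNearestPoint C x p := by
  have hu := existsUnique_isNearestPoint hne hcl hcv x
  have hs : IsNearestPoint C x (projOnto C x) := by
    rw [projOnto, dif_pos hu.exists]
    exact hu.exists.choose_spec
  exact ⟨fun h => h ▸ hs, fun h => hu.unique hs h⟩

/-- The smallest closed convex cone that contains `S`. -/
def closedConvexConeHull (S : Set H) : ConvexCone ℝ H :=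
  sInf {C : ConvexCone ℝ H | IsClosed (C : Set H) ∧ S ⊆ (C : Set H)}

theorem isLeast_closedConvexConeHull (S : Set H) :
    IsLeast {C : ConvexCone ℝ H | IsClosed (C : Set H) ∧ S ⊆ (C : Set H)}
      (closedConvexConeHull S) := by
  refine ⟨⟨?_, ?_⟩, fun C hC => sInf_le hC⟩
  · rw [closedConvexConeHull, ConvexCone.coe_sInf]
    exact isClosed_biInter fun C hC => hC.1
  · rw [closedConvexConeHull, ConvexCone.coe_sInf]
    exact Set.subset_iInter₂ fun C hC => hC.2

/-- `(x, u)` solves the problem of finding `x ∈ V` and `u ∈ Vᗮ` with `u ∈ B x`. -/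
def IsPartialInverseSolution (B : H → Set H) (V : Submodule ℝ H) (x u : H) : Prop :=
  x ∈ V ∧ u ∈ Vᗮ ∧ u ∈ B x

/-- The sequence `(x n, u n)` is generated by Spingarn's method of partial inverses:
`x 0 ∈ V`, `u 0 ∈ Vᗮ`, `x (n + 1) = proj_V (J_B (x n + u n))` and
`u (n + 1) = proj_Vᗮ (J_{B⁻¹} (x n + u n))`. -/
structure IsPartialInverseSequence (B : H → Set H) (V : Submodule ℝ H)
    [V.HasOrthogonalProjection] (x u : ℕ → H) : Prop where
  x_zero_mem : x 0 ∈ V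
  u_zero_mem : u 0 ∈ Vᗮ
  x_succ : ∀ n, ∃ p ∈ resolvent B (x n + u n), x (n + 1) = V.starProjection p
  u_succ : ∀ n, ∃ q ∈ resolvent (inverse B) (x n + u n), u (n + 1) = Vᗮ.starProjection q

/-- Alternating projections: `z 0 = a` and `z (n + 1) = proj_K (proj_V (z n))`. -/
def alternatingProj (V : Submodule ℝ H) [V.HasOrthogonalProjection] (K : Set H) (a : H) :
    ℕ → H
  | 0 => a
  | n + 1 => projOnto K (V.starProjection (alternatingProj V K a n))

end SetValued

section Example

variable {H : Type*} [NormedAddCommGroup H] [InnerProductSpace ℝ H]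

/-- The curve `ξ ↦ exp (-100 ξ³) e₀ + cos (π (ξ - ⌊ξ⌋) / 2) e_{⌊ξ⌋ + 1} +
sin (π (ξ - ⌊ξ⌋) / 2) e_{⌊ξ⌋ + 2}`, to be used for `ξ ≥ 0`. -/
def curve (e : ℕ → H) (ξ : ℝ) : H :=
  Real.exp (-100 * ξ ^ 3) • e 0 +
    Real.cos (Real.pi * (ξ - ⌊ξ⌋₊) / 2) • e (⌊ξ⌋₊ + 1) +
    Real.sin (Real.pi * (ξ - ⌊ξ⌋₊) / 2) • e (⌊ξ⌋₊ + 2)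

/-- The cone `K`: the smallest closed convex cone that contains the curve over `[0, ∞)`. -/
def coneK (e : ℕ → H) : ConvexCone ℝ H := closedConvexConeHull (curve e '' Set.Ici 0)

/-- The hyperplane `V = {e₀}ᗮ`. -/
abbrev hyperplaneV (e : ℕ → H) : Submodule ℝ H := (ℝ ∙ e 0)ᗮ

/-- The operator `B = (proj_V ∘ proj_K ∘ proj_V)⁻¹ - Id`. -/
def operatorB (e : ℕ → H) : H → Set H :=
  inverseSubId fun x =>
    (hyperplaneV e).starProjection
      (projOnto (coneK e : Set H) ((hyperplaneV e).starProjection x))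

end Example

end Splitting

end

/-!
`B` is `T⁻¹ - Id` for the firmly nonexpansive map `T = proj_V ∘ proj_K ∘ proj_V`. The resolvents
of `B` and `B⁻¹` are `T` and `Id - T`, so the method of partial inverses keeps `u = 0` and iterates `x ↦ T x`
(`isPartialInverseSequence_inverseSubId_iff`); the iterates are the shadows `proj_V z_n` of the
alternating projections.

*Weak convergence.* The squared heights of the points `z_n` above `V` are bounded by the decrements
of the squared norms of the shadows, so the heights tend to `0`. On `K` each coordinate other than
the zeroth is nonnegative and at most a constant, depending on the coordinate, times the height
(`inner_mul_le_of_mem_coneK`). Hence all coordinates of the bounded sequence of shadows tend to `0`.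

*No strong convergence.* The norms of the shadows stay above `1 / 2`. Write
`f ξ = exp (-100 ξ³)` for the height of the curve. The residual `q = x - proj_K x` lies in the polar
cone of `K` and is orthogonal to `proj_K x`; modulo the height `η` of `proj_K x`, it is an optimal
dual vector: its component at parameter `ξ` is at most `η f ξ`, with equality where `proj_K x` is
supported. Two consequences of optimality (`dual_replacement`) drive the proof. Leading coordinates
that vanish stay zero (`inner_eq_zero_of_proj`). And if `m + 1` is the first coordinate that is
nonzero for `proj_K x`, whose coordinates `m + 1` and `m + 2` are `N' (cos θ', sin θ')`, then a
constraint at an angle at most `θ'` is active (`exists_active_constraint`). Comparing it with its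
neighbours shows that in this quarter plane the tangential component of `q` is at least `60 m²`
times the radial one, because `|f'| / f` is of order `m²` (`tangential_component_ge`). So while the iterate
turns through the quarter plane number `m`, its radius there decreases by `O(1 / m²)` in total. The
constants are small enough for the sum of these losses to remain below `1 / 2`; `IsNearCurve` is the
corresponding invariant and `IsNearCurve.exists_projOnto` its induction step.
-/

namespace Splitting

/-! ### Resolvents of firmly nonexpansive maps -/

section Resolvents

variable {H : Type*} [NormedAddCommGroup H]

theorem mem_inverseSubId (T : H → H) (x u : H) : u ∈ inverseSubId T x ↔ T (x + u) = x := by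
  simp only [inverseSubId, inverse, Set.sub_singleton, Set.mem_image, Set.mem_ofPred_eq,
    Set.mem_singleton_iff]
  constructor
  · rintro ⟨s, hs, rfl⟩
    rw [add_sub_cancel, ← hs]
  · intro h
    exact ⟨x + u, h.symm, by abel⟩

theorem mem_resolvent_inverseSubId (T : H → H) (y p : H) :
    p ∈ resolvent (inverseSubId T) y ↔ T y = p := by
  simp only [resolvent, inverse, Set.singleton_add, Set.mem_image, Set.mem_ofPred_eq,
    mem_inverseSubId]
  constructor
  · rintro ⟨u, hu, rfl⟩
    exact hu
  · intro h
    exact ⟨y - p, by rwa [add_sub_cancel], by abel⟩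

theorem mem_resolvent_inverse_inverseSubId (T : H → H) (y q : H) :
    q ∈ resolvent (inverse (inverseSubId T)) y ↔ y - T y = q := by
  have key : q ∈ resolvent (inverse (inverseSubId T)) y ↔ T y = y - q := by
    simp only [resolvent, inverse, Set.singleton_add, Set.mem_image, Set.mem_ofPred_eq,
      mem_inverseSubId]
    constructor
    · rintro ⟨u, hu, rfl⟩
      rw [add_comm, hu]
      abel
    · intro h
      exact ⟨y - q, by rwa [sub_add_cancel], by abel⟩
  rw [key]
  constructor <;> intro h
  · rw [h]
    abel
  · rw [← h]
    abel

variable [InnerProductSpace ℝ H]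

/-- `T` is firmly nonexpansive: `‖T x - T y‖² ≤ ⟪T x - T y, x - y⟫`. -/
def IsFirmlyNonexpansive (T : H → H) : Prop :=
  ∀ x y, ⟪T x - T y, T x - T y⟫_ℝ ≤ ⟪T x - T y, x - y⟫_ℝ

theorem IsFirmlyNonexpansive.isMaximallyMonotone {T : H → H} (hT : IsFirmlyNonexpansive T) :
    IsMaximallyMonotone (inverseSubId T) := by
  refine ⟨?_, ?_⟩
  · intro x y u hu v hv
    rw [mem_inverseSubId] at hu hv
    have h := hT (x + u) (y + v)
    rw [hu, hv] at h
    have e : x + u - (y + v) = (x - y) + (u - v) := by abel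
    rw [e, inner_add_right] at h
    linarith
  · intro A hA hsub
    funext x
    refine Set.Subset.antisymm (fun u hu => ?_) (hsub x)
    -- compare `(x, u)` with the point of the graph of `T⁻¹ - Id` that has the same sum
    have hp : x + u - T (x + u) ∈ inverseSubId T (T (x + u)) := by
      rw [mem_inverseSubId, add_sub_cancel]
    have h := hA x (T (x + u)) u hu _ (hsub _ hp)
    have e : u - (x + u - T (x + u)) = -(x - T (x + u)) := by abel
    rw [e, inner_neg_right] at h
    have h0 : x - T (x + u) = 0 :=
      inner_self_eq_zero.1 (le_antisymm (by linarith) real_inner_self_nonneg)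
    rw [mem_inverseSubId]
    exact (sub_eq_zero.1 h0).symm

end Resolvents

/-! ### Projections onto closed convex cones -/

section Cones

variable {H : Type*} [NormedAddCommGroup H] [InnerProductSpace ℝ H]

theorem zero_mem_of_isClosed_cone {K : ConvexCone ℝ H} (hne : (K : Set H).Nonempty)
    (hcl : IsClosed (K : Set H)) : (0 : H) ∈ K := by
  obtain ⟨k, hk⟩ := hne
  have ht : Tendsto (fun n : ℕ => (1 / ((n : ℝ) + 1)) • k) atTop (𝓝 ((0 : ℝ) • k)) :=
    tendsto_one_div_add_atTop_nhds_zero_nat.smul_const k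
  rw [zero_smul] at ht
  exact hcl.mem_of_tendsto ht (Eventually.of_forall fun n => K.smul_mem (by positivity) hk)

/-- Moreau's characterization of the projection onto a closed convex cone: the residual
`x - proj_K x` is orthogonal to `proj_K x` and lies in the polar cone of `K`. -/
theorem projOnto_cone_spec [CompleteSpace H] {K : ConvexCone ℝ H} (hne : (K : Set H).Nonempty)
    (hcl : IsClosed (K : Set H)) (x : H) :
    projOnto (K : Set H) x ∈ K ∧
      ⟪x - projOnto (K : Set H) x, projOnto (K : Set H) x⟫_ℝ = 0 ∧
      ∀ k ∈ K, ⟪x - projOnto (K : Set H) x, k⟫_ℝ ≤ 0 := by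
  obtain ⟨hp, hmin⟩ := (projOnto_eq_iff hne hcl K.convex x _).1 rfl
  set p := projOnto (K : Set H) x
  have key : ∀ w ∈ K, ⟪x - p, w - p⟫_ℝ ≤ 0 := by
    have : Nonempty (K : Set H) := ⟨⟨p, hp⟩⟩
    refine (norm_eq_iInf_iff_real_inner_le_zero K.convex hp).1 (le_antisymm ?_ ?_)
    · exact le_ciInf fun w => hmin w w.2
    · exact ciInf_le (f := fun w : (K : Set H) => ‖x - w‖)
        ⟨0, Set.forall_mem_range.2 fun _ => norm_nonneg _⟩ ⟨p, hp⟩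
  refine ⟨hp, ?_, fun k hk => ?_⟩
  · have h1 := key _ (K.add_mem hp hp)
    have h2 := key 0 (zero_mem_of_isClosed_cone hne hcl)
    rw [add_sub_cancel_right] at h1
    rw [zero_sub, inner_neg_right] at h2
    linarith
  · have h1 := key _ (K.add_mem hp hk)
    rwa [add_sub_cancel_left] at h1

theorem isFirmlyNonexpansive_projOnto_cone [CompleteSpace H] {K : ConvexCone ℝ H}
    (hne : (K : Set H).Nonempty) (hcl : IsClosed (K : Set H)) :
    IsFirmlyNonexpansive (projOnto (K : Set H)) := by
  intro x y
  obtain ⟨hpx, hx0, hx⟩ := projOnto_cone_spec hne hcl x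
  obtain ⟨hpy, hy0, hy⟩ := projOnto_cone_spec hne hcl y
  have h1 := hx _ hpy
  have h2 := hy _ hpx
  simp only [inner_sub_left, inner_sub_right] at *
  have c1 := real_inner_comm x (projOnto (K : Set H) x)
  have c2 := real_inner_comm y (projOnto (K : Set H) y)
  have c3 := real_inner_comm y (projOnto (K : Set H) x)
  have c4 := real_inner_comm x (projOnto (K : Set H) y)
  linarith

theorem IsFirmlyNonexpansive.starProjection_conj {T : H → H} (hT : IsFirmlyNonexpansive T)
    (V : Submodule ℝ H) [V.HasOrthogonalProjection] :
    IsFirmlyNonexpansive fun x => V.starProjection (T (V.starProjection x)) := by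
  intro x y
  have h := hT (V.starProjection x) (V.starProjection y)
  simp only [← map_sub] at h ⊢
  set d := T (V.starProjection x) - T (V.starProjection y)
  have hs : ⟪V.starProjection d, x - y⟫_ℝ = ⟪d, V.starProjection (x - y)⟫_ℝ :=
    V.starProjection_isSymmetric d (x - y)
  rw [hs]
  refine le_trans ?_ h
  rw [real_inner_self_eq_norm_sq, real_inner_self_eq_norm_sq]
  have := V.norm_starProjection_apply_le d
  gcongr

end Cones

/-! ### The profile of the curve -/

section Profile

/-- The height above `V` of the point of the curve with parameter `m + 2 φ / π`. -/
noncomputable def arcHeight (m : ℕ) (φ : ℝ) : ℝ :=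
  Real.exp (-100 * (m + 2 * φ / Real.pi) ^ 3)

theorem arcHeight_pos (m : ℕ) (φ : ℝ) : 0 < arcHeight m φ := Real.exp_pos _

theorem continuous_arcHeight (m : ℕ) : Continuous (arcHeight m) := by
  unfold arcHeight
  fun_prop

/-- The parameter increases by `2 (ψ - φ) / π`, and its cube by at least `3 m²` times as much. -/
theorem arcHeight_mul_exp_le (m : ℕ) {φ ψ : ℝ} (hφ : 0 ≤ φ) (h : φ ≤ ψ) :
    arcHeight m ψ * Real.exp (190 * (m : ℝ) ^ 2 * (ψ - φ)) ≤ arcHeight m φ := by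
  unfold arcHeight
  rw [← Real.exp_add]
  apply Real.exp_le_exp.2
  have hπ := Real.pi_pos
  set s := 2 * φ / Real.pi
  set t := 2 * ψ / Real.pi
  have hs : 0 ≤ s := by positivity
  -- `0.635 < 2 / π`, and `300 * 0.635 > 190`
  have hts : 0.635 * (ψ - φ) ≤ t - s := by
    have : t - s = (ψ - φ) * (2 / Real.pi) := by simp only [s, t]; ring
    rw [this, mul_comm]
    refine mul_le_mul_of_nonneg_left ?_ (by linarith)
    rw [le_div_iff₀ hπ]
    linarith [Real.pi_lt_d4]
  have hm : (0 : ℝ) ≤ m := by positivity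
  have hst : s ≤ t := by linarith
  have h3 : ((m : ℝ) + t) ^ 3 - (m + s) ^ 3 ≥ 3 * (m : ℝ) ^ 2 * (t - s) := by
    have e : ((m : ℝ) + t) ^ 3 - (m + s) ^ 3 - 3 * (m : ℝ) ^ 2 * (t - s) =
        (t - s) * (3 * m * (t + s) + (t ^ 2 + t * s + s ^ 2)) := by ring
    have : 0 ≤ (t - s) * (3 * m * (t + s) + (t ^ 2 + t * s + s ^ 2)) := by
      have ht : 0 ≤ t := hs.trans hst
      have : 0 ≤ t - s := by linarith
      positivity
    linarith
  have h4 : (m : ℝ) ^ 2 * (0.635 * (ψ - φ)) ≤ (m : ℝ) ^ 2 * (t - s) := by gcongr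
  have h5 : 0 ≤ (m : ℝ) ^ 2 * (ψ - φ) := by
    have : 0 ≤ ψ - φ := by linarith
    positivity
  nlinarith

theorem arcHeight_le (m : ℕ) {φ ψ : ℝ} (hφ : 0 ≤ φ) (h : φ ≤ ψ) :
    arcHeight m ψ ≤ arcHeight m φ := by
  refine le_trans ?_ (arcHeight_mul_exp_le m hφ h)
  refine le_mul_of_one_le_right (arcHeight_pos m ψ).le (Real.one_le_exp ?_)
  have : 0 ≤ ψ - φ := by linarith
  positivity

theorem arcHeight_pi_div_two (m : ℕ) : arcHeight m (Real.pi / 2) = arcHeight (m + 1) 0 := by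
  unfold arcHeight
  have : 2 * (Real.pi / 2) / Real.pi = 1 := by field_simp
  rw [this]
  simp

theorem arcHeight_zero_succ_le (m : ℕ) {φ : ℝ} (hφ : 0 ≤ φ) (h : φ ≤ Real.pi / 2) :
    arcHeight (m + 1) 0 ≤ arcHeight m φ := by
  rw [← arcHeight_pi_div_two]
  exact arcHeight_le m hφ h

theorem antitone_arcHeight_zero : Antitone fun m : ℕ => arcHeight m 0 :=
  antitone_nat_of_succ_le fun m => arcHeight_zero_succ_le m le_rfl (by positivity)

theorem arcHeight_zero_mul_le {k : ℕ} (hk : 1 ≤ k) :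
    arcHeight k 0 * (2 ^ (k + 1) * (400 * (k : ℝ) ^ 2)) ≤ 1 := by
  have hk' : (1 : ℝ) ≤ k := by exact_mod_cast hk
  have h1 : arcHeight k 0 ≤ Real.exp (-(100 * (k : ℝ))) := by
    unfold arcHeight
    apply Real.exp_le_exp.2
    have : (k : ℝ) ≤ (k : ℝ) ^ 3 := le_self_pow₀ hk' (by norm_num)
    simp only [mul_zero, zero_div, add_zero]
    linarith
  have h2 : (2 : ℝ) ^ (k + 1) ≤ Real.exp (50 * k) := by
    have e1 : (2 : ℝ) ^ (k + 1) ≤ Real.exp 1 ^ (k + 1) := by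
      gcongr
      linarith [Real.exp_one_gt_d9]
    refine e1.trans ?_
    rw [← Real.exp_nat_mul]
    apply Real.exp_le_exp.2
    push_cast
    linarith
  have h3 : 400 * (k : ℝ) ^ 2 ≤ Real.exp (50 * k) := by
    have := Real.quadratic_le_exp_of_nonneg (x := 50 * (k : ℝ)) (by positivity)
    nlinarith
  calc arcHeight k 0 * (2 ^ (k + 1) * (400 * (k : ℝ) ^ 2))
      ≤ Real.exp (-(100 * (k : ℝ))) * (Real.exp (50 * k) * Real.exp (50 * k)) := by
        gcongr
    _ = 1 := by
        rw [← Real.exp_add, ← Real.exp_add, ← Real.exp_zero]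
        congr 1
        ring

end Profile

/-! ### The cone `K` -/

section ConeK

variable {H : Type*} [NormedAddCommGroup H] [InnerProductSpace ℝ H]

theorem curve_arc (e : ℕ → H) (m : ℕ) {φ : ℝ} (h0 : 0 ≤ φ) (h1 : φ ≤ Real.pi / 2) :
    curve e (m + 2 * φ / Real.pi) =
      arcHeight m φ • e 0 + Real.cos φ • e (m + 1) + Real.sin φ • e (m + 2) := by
  have hπ := Real.pi_pos
  rcases h1.eq_or_lt with rfl | h1
  · have h2 : (m : ℝ) + 2 * (Real.pi / 2) / Real.pi = (m + 1 : ℕ) := by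
      push_cast
      field_simp
    unfold curve arcHeight
    rw [h2, Nat.floor_natCast]
    simp [add_assoc]
  · have h2 : ⌊(m : ℝ) + 2 * φ / Real.pi⌋₊ = m := by
      rw [Nat.floor_eq_iff (by positivity)]
      refine ⟨le_add_of_nonneg_right (by positivity), ?_⟩
      have : 2 * φ / Real.pi < 1 := by
        rw [div_lt_one hπ]
        linarith
      linarith
    have h3 : Real.pi * ((m : ℝ) + 2 * φ / Real.pi - m) / 2 = φ := by
      field_simp
      ring
    unfold curve arcHeight
    rw [h2, h3]

theorem exists_eq_arc {ξ : ℝ} (hξ : 0 ≤ ξ) :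
    ∃ (m : ℕ) (φ : ℝ), 0 ≤ φ ∧ φ ≤ Real.pi / 2 ∧ ξ = m + 2 * φ / Real.pi := by
  have hπ := Real.pi_pos
  refine ⟨⌊ξ⌋₊, Real.pi / 2 * (ξ - ⌊ξ⌋₊), ?_, ?_, ?_⟩
  · have := Nat.floor_le hξ
    have : 0 ≤ ξ - ⌊ξ⌋₊ := by linarith
    positivity
  · have := Nat.lt_floor_add_one ξ
    refine mul_le_of_le_one_right (by positivity) (by linarith)
  · field_simp
    ring

theorem arc_mem_coneK (e : ℕ → H) (m : ℕ) {φ : ℝ} (h0 : 0 ≤ φ) (h1 : φ ≤ Real.pi / 2) :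
    arcHeight m φ • e 0 + Real.cos φ • e (m + 1) + Real.sin φ • e (m + 2) ∈ coneK e := by
  have hπ := Real.pi_pos
  have h := (isLeast_closedConvexConeHull (curve e '' Set.Ici 0)).1.2
  rw [← curve_arc e m h0 h1]
  exact h ⟨_, Set.mem_Ici.2 (by positivity), rfl⟩

theorem isClosed_coneK (e : ℕ → H) : IsClosed (coneK e : Set H) :=
  (isLeast_closedConvexConeHull (curve e '' Set.Ici 0)).1.1

theorem coneK_nonempty (e : ℕ → H) : (coneK e : Set H).Nonempty :=
  ⟨_, arc_mem_coneK e 0 le_rfl (by positivity)⟩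

theorem zero_mem_coneK (e : ℕ → H) : (0 : H) ∈ coneK e :=
  zero_mem_of_isClosed_cone (coneK_nonempty e) (isClosed_coneK e)

theorem smul_mem_coneK {e : ℕ → H} {c : ℝ} (hc : 0 ≤ c) {x : H} (hx : x ∈ coneK e) :
    c • x ∈ coneK e := by
  rcases hc.eq_or_lt with rfl | hc
  · rw [zero_smul]
    exact zero_mem_coneK e
  · exact (coneK e).smul_mem hc hx

/-- A vector belongs to the polar cone of `K` as soon as it has nonpositive inner products with
the points of the curve. -/
theorem inner_le_zero_of_mem_coneK {e : ℕ → H} {q : H}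
    (hq : ∀ (m : ℕ) (φ : ℝ), 0 ≤ φ → φ ≤ Real.pi / 2 →
      arcHeight m φ * ⟪q, e 0⟫_ℝ + Real.cos φ * ⟪q, e (m + 1)⟫_ℝ +
        Real.sin φ * ⟪q, e (m + 2)⟫_ℝ ≤ 0) {k : H} (hk : k ∈ coneK e) :
    ⟪q, k⟫_ℝ ≤ 0 := by
  let C : ConvexCone ℝ H :=
    { carrier := {k | ⟪q, k⟫_ℝ ≤ 0}
      smul_mem' := fun c hc x hx => by
        simp only [Set.mem_ofPred_eq, inner_smul_right] at hx ⊢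
        exact mul_nonpos_of_nonneg_of_nonpos hc.le hx
      add_mem' := fun x hx y hy => by
        simp only [Set.mem_ofPred_eq, inner_add_right] at hx hy ⊢
        linarith }
  have hC : coneK e ≤ C := (isLeast_closedConvexConeHull (curve e '' Set.Ici 0)).2 ⟨?_, ?_⟩
  · exact hC hk
  · exact isClosed_le (f := fun k => ⟪q, k⟫_ℝ) (continuous_const.inner continuous_id)
      continuous_const
  · rintro _ ⟨ξ, hξ, rfl⟩
    obtain ⟨m, φ, h0, h1, rfl⟩ := exists_eq_arc (Set.mem_Ici.1 hξ)
    rw [curve_arc e m h0 h1]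
    change ⟪q, _⟫_ℝ ≤ 0
    simpa only [inner_add_right, inner_smul_right] using hq m φ h0 h1

variable {e : ℕ → H} (he : Orthonormal ℝ e)

include he

theorem inner_basis (i j : ℕ) : ⟪e i, e j⟫_ℝ = if i = j then 1 else 0 :=
  orthonormal_iff_ite.1 he i j

theorem inner_nonneg_of_mem_coneK (i : ℕ) {k : H} (hk : k ∈ coneK e) : 0 ≤ ⟪e i, k⟫_ℝ := by
  have h := inner_le_zero_of_mem_coneK (q := -e i) (fun m φ h0 h1 => ?_) hk
  · rw [inner_neg_left] at h
    linarith
  · have hs := Real.sin_nonneg_of_nonneg_of_le_pi h0 (by linarith [Real.pi_pos])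
    have hc := Real.cos_nonneg_of_neg_pi_div_two_le_of_le (by linarith [Real.pi_pos]) h1
    have ha := (arcHeight_pos m φ).le
    have hb : ∀ j, ⟪-e i, e j⟫_ℝ ≤ 0 := fun j => by
      rw [inner_neg_left, inner_basis he]
      split_ifs <;> norm_num
    have := mul_nonpos_of_nonneg_of_nonpos ha (hb 0)
    have := mul_nonpos_of_nonneg_of_nonpos hc (hb (m + 1))
    have := mul_nonpos_of_nonneg_of_nonpos hs (hb (m + 2))
    linarith

/-- The coordinate `e (i + 1)` is nonzero on the curve only for parameters in `(i - 1, i + 1)`,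
where the height is at least its value at `i + 1`. -/
theorem inner_mul_le_of_mem_coneK (i : ℕ) {k : H} (hk : k ∈ coneK e) :
    ⟪e (i + 1), k⟫_ℝ * arcHeight (i + 1) 0 ≤ ⟪e 0, k⟫_ℝ := by
  have h := inner_le_zero_of_mem_coneK (q := arcHeight (i + 1) 0 • e (i + 1) - e 0)
    (fun m φ h0 h1 => ?_) hk
  · rw [inner_sub_left, real_inner_smul_left] at h
    linarith
  · have ha := arcHeight_pos m φ
    have hf := arcHeight_pos (i + 1) 0
    have hs1 := Real.sin_le_one φ
    have hc1 := Real.cos_le_one φ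
    have hd := arcHeight_zero_succ_le m h0 h1
    simp only [inner_sub_left, real_inner_smul_left, inner_basis he]
    rcases lt_trichotomy i m with hm | rfl | hm
    · simp [show i ≠ m by omega, show i ≠ m + 1 by omega, ha.le]
    · have : Real.cos φ * arcHeight (i + 1) 0 ≤ 1 * arcHeight (i + 1) 0 := by gcongr
      simp
      linarith
    · rcases eq_or_ne i (m + 1) with rfl | hne
      · have h2 := antitone_arcHeight_zero (Nat.le_succ (m + 1))
        have : Real.sin φ * arcHeight (m + 2) 0 ≤ 1 * arcHeight (m + 2) 0 :=
          mul_le_mul_of_nonneg_right hs1 (arcHeight_pos _ _).le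
        simp only [Nat.succ_eq_add_one] at h2
        simp
        have e2 : arcHeight (m + 1 + 1) 0 = arcHeight (m + 2) 0 := rfl
        linarith
      · simp [show i ≠ m by omega, show i ≠ m + 1 by omega, ha.le]

end ConeK

/-! ### Angular speed inside one quarter plane -/

section AngularSpeed

theorem exists_polar {a c : ℝ} (ha : 0 ≤ a) (hc : 0 ≤ c) :
    ∃ N θ : ℝ, 0 ≤ N ∧ 0 ≤ θ ∧ θ ≤ Real.pi / 2 ∧ a = N * Real.cos θ ∧ c = N * Real.sin θ :=
  ⟨‖(⟨a, c⟩ : ℂ)‖, Complex.arg ⟨a, c⟩, norm_nonneg _, Complex.arg_nonneg_iff.2 hc,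
    (abs_le.1 (Complex.abs_arg_le_pi_div_two_iff.2 ha)).2,
    (Complex.norm_mul_cos_arg ⟨a, c⟩).symm, (Complex.norm_mul_sin_arg ⟨a, c⟩).symm⟩

/-- Complementary slackness. If the pair `(A, C)` is a feasible dual vector that cannot be improved
in the direction of `N (cos θ, sin θ)` by lowering `C`, then one of the constraints with angle in
`[0, θ]` is active: otherwise a small multiple of `(sin ψ, -cos ψ)`, with `ψ` slightly larger than
`θ`, could be added to `(A, C)`. -/
theorem exists_active_constraint {m : ℕ} {A C η N θ : ℝ} (hN : 0 < N)
    (hθ0 : 0 ≤ θ) (hθ1 : θ < Real.pi / 2)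
    (hfeas : ∀ φ, 0 ≤ φ → φ ≤ Real.pi / 2 →
      A * Real.cos φ + C * Real.sin φ ≤ η * arcHeight m φ)
    (hopt : ∀ A' C' : ℝ, (∀ φ, 0 ≤ φ → φ ≤ Real.pi / 2 →
      A' * Real.cos φ + C' * Real.sin φ ≤ η * arcHeight m φ) → C' ≤ C →
      (A' - A) * (N * Real.cos θ) + (C' - C) * (N * Real.sin θ) ≤ 0) :
    ∃ φ, 0 ≤ φ ∧ φ ≤ θ ∧ A * Real.cos φ + C * Real.sin φ = η * arcHeight m φ := by
  by_contra! hno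
  have hpos : ∀ φ, 0 ≤ φ → φ ≤ θ → 0 < η * arcHeight m φ - (A * Real.cos φ + C * Real.sin φ) :=
    fun φ h0 h1 => sub_pos.2 (lt_of_le_of_ne (hfeas φ h0 (h1.trans hθ1.le)) (hno φ h0 h1))
  set g : ℝ → ℝ := fun φ => η * arcHeight m φ - (A * Real.cos φ + C * Real.sin φ) with hg
  have hgc : Continuous g := by
    have := continuous_arcHeight m
    fun_prop
  -- the constraints stay inactive up to some `ψ > θ`
  obtain ⟨ψ, hψθ, hψ1, hψ⟩ : ∃ ψ, θ < ψ ∧ ψ < Real.pi / 2 ∧ ∀ φ, 0 ≤ φ → φ ≤ ψ → 0 < g φ := by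
    have h1 : ∀ᶠ x in 𝓝 θ, 0 < g x := 
      hgc.continuousAt.eventually (lt_mem_nhds (hpos θ hθ0 le_rfl))
    obtain ⟨ε, hε, hball⟩ := Metric.eventually_nhds_iff.1 h1
    refine ⟨min (θ + ε / 2) ((θ + Real.pi / 2) / 2), lt_min (by linarith) (by linarith),
      (min_le_right _ _).trans_lt (by linarith), fun φ h0 h1 => ?_⟩
    rcases le_total φ θ with h | h
    · exact hpos φ h0 h
    · have := h1.trans (min_le_left _ _)
      refine hball ?_
      rw [Real.dist_eq, abs_of_nonneg (by linarith)]
      linarith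
  obtain ⟨φ₀, hφ₀, hmin⟩ := isCompact_Icc.exists_isMinOn
    (Set.nonempty_Icc.2 (hθ0.trans hψθ.le)) hgc.continuousOn
  have hδ := hψ φ₀ hφ₀.1 hφ₀.2
  have hsin : 0 ≤ Real.sin ψ := Real.sin_nonneg_of_nonneg_of_le_pi (by linarith) (by linarith)
  have hcos : 0 ≤ Real.cos ψ := Real.cos_nonneg_of_neg_pi_div_two_le_of_le (by linarith) hψ1.le
  have h := hopt (A + g φ₀ * Real.sin ψ) (C - g φ₀ * Real.cos ψ) (fun φ h0 h1 => ?_) (by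
    have := mul_nonneg hδ.le hcos
    linarith)
  · have e : (A + g φ₀ * Real.sin ψ - A) * (N * Real.cos θ) +
        (C - g φ₀ * Real.cos ψ - C) * (N * Real.sin θ) = g φ₀ * N * Real.sin (ψ - θ) := by
      rw [Real.sin_sub]
      ring
    have hs : 0 < Real.sin (ψ - θ) :=
      Real.sin_pos_of_pos_of_lt_pi (by linarith) (by linarith [Real.pi_pos])
    rw [e] at h
    have : 0 < g φ₀ * N * Real.sin (ψ - θ) := by positivity
    linarith
  · have e : (A + g φ₀ * Real.sin ψ) * Real.cos φ + (C - g φ₀ * Real.cos ψ) * Real.sin φ =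
        A * Real.cos φ + C * Real.sin φ + g φ₀ * Real.sin (ψ - φ) := by
      rw [Real.sin_sub]
      ring
    rw [e]
    rcases le_total φ ψ with hle | hle
    · have hm : g φ₀ ≤ g φ := hmin (Set.mem_Icc.2 ⟨h0, hle⟩)
      have : g φ₀ * Real.sin (ψ - φ) ≤ g φ₀ * 1 := by
        gcongr
        exact Real.sin_le_one _
      simp only [hg] at *
      linarith
    · have : Real.sin (ψ - φ) ≤ 0 :=
        Real.sin_nonpos_of_nonpos_of_neg_pi_le (by linarith) (by linarith [Real.pi_pos])
      have := mul_nonpos_of_nonneg_of_nonpos hδ.le this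
      have := hfeas φ h0 h1
      linarith

/-- The tangential component of an optimal dual vector at angle `θ` is at least `60 m²` times the
bound on its radial component, because the logarithmic derivative of the height is at most
`-(600 / π) m²`. An active constraint at a smaller angle gives this by comparison with the
constraint at `θ`; an active constraint at `θ` itself, by comparison with one at a slightly larger
angle. -/
theorem tangential_component_ge {m : ℕ} (hm : 1 ≤ m) {A C η N θ : ℝ} (hη : 0 ≤ η) (hN : 0 < N)
    (hθ0 : 0 ≤ θ) (hθ1 : θ < Real.pi / 2)
    (hfeas : ∀ φ, 0 ≤ φ → φ ≤ Real.pi / 2 →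
      A * Real.cos φ + C * Real.sin φ ≤ η * arcHeight m φ)
    (hopt : ∀ A' C' : ℝ, (∀ φ, 0 ≤ φ → φ ≤ Real.pi / 2 →
      A' * Real.cos φ + C' * Real.sin φ ≤ η * arcHeight m φ) → C' ≤ C →
      (A' - A) * (N * Real.cos θ) + (C' - C) * (N * Real.sin θ) ≤ 0) :
    60 * (m : ℝ) ^ 2 * (η * arcHeight m θ) ≤ A * Real.sin θ - C * Real.cos θ := by
  have hm' : (1 : ℝ) ≤ (m : ℝ) ^ 2 := one_le_pow₀ (by exact_mod_cast hm)
  have hπ := Real.pi_pos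
  obtain ⟨φ, hφ0, hφθ, hact⟩ := exists_active_constraint hN hθ0 hθ1 hfeas hopt
  set F := η * arcHeight m θ with hF
  have hF0 : 0 ≤ F := mul_nonneg hη (arcHeight_pos m θ).le
  set α := A * Real.cos θ + C * Real.sin θ with hα
  set β := A * Real.sin θ - C * Real.cos θ with hβ
  have hαF : α ≤ F := hfeas θ hθ0 hθ1.le
  have rot : ∀ φ, A * Real.cos φ + C * Real.sin φ =
      α * Real.cos (θ - φ) + β * Real.sin (θ - φ) := fun φ => by
    rw [Real.cos_sub, Real.sin_sub, hα, hβ]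
    linear_combination (-(A * Real.cos φ + C * Real.sin φ)) * Real.sin_sq_add_cos_sq θ
  have conclude : ∀ ω, 0 < ω → ω ≤ Real.pi / 2 →
      60 * (m : ℝ) ^ 2 * F * ω ≤ β * Real.sin ω → 60 * (m : ℝ) ^ 2 * F ≤ β := by
    intro ω h0 h1 h
    have hs : 0 < Real.sin ω := Real.sin_pos_of_pos_of_lt_pi h0 (by linarith)
    refine le_of_mul_le_mul_right (le_trans ?_ h) hs
    gcongr
    exact (Real.sin_lt h0).le
  rcases hφθ.eq_or_lt with rfl | hlt
  · set ω := min (Real.pi / 2 - φ) (1 / (190 * (m : ℝ) ^ 2)) with hω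
    have hω0 : 0 < ω := lt_min (by linarith) (by positivity)
    have hω1 : ω ≤ Real.pi / 2 - φ := min_le_left _ _
    have hω2 : ω * (190 * (m : ℝ) ^ 2) ≤ 1 := by
      rw [← le_div_iff₀ (by positivity)]
      exact min_le_right _ _
    refine conclude ω hω0 (by linarith) ?_
    have h1 := hfeas (φ + ω) (by linarith) (by linarith)
    rw [rot, show φ - (φ + ω) = -ω by ring, Real.cos_neg, Real.sin_neg] at h1
    have h2 := arcHeight_mul_exp_le m hφ0 (show φ ≤ φ + ω by linarith)
    rw [add_sub_cancel_left] at h2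
    have h3 := Real.add_one_le_exp (190 * (m : ℝ) ^ 2 * ω)
    have hY : 0 ≤ 190 * (m : ℝ) ^ 2 * ω := by positivity
    set Y := 190 * (m : ℝ) ^ 2 * ω with hYdef
    have hG := arcHeight_pos m (φ + ω)
    have h4 : arcHeight m (φ + ω) * (1 + Y) ≤ arcHeight m φ := by
      refine le_trans ?_ h2
      gcongr
      linarith
    -- `1 / (1 + Y) ≤ 1 - Y / 2`, since `Y ≤ 1`
    have h5 : η * arcHeight m (φ + ω) ≤ F * (1 - Y / 2) := by
      have h6 : η * arcHeight m (φ + ω) * (1 + Y) ≤ F := by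
        rw [hF, mul_assoc]
        gcongr
      have h7 : 0 ≤ η * arcHeight m (φ + ω) * (Y * (1 - Y)) := by
        have : 0 ≤ 1 - Y := by linarith
        positivity
      have h8 : 0 ≤ 1 - Y / 2 := by linarith
      nlinarith [mul_le_mul_of_nonneg_right h6 h8]
    have hαe : α = F := hact
    have hcos := Real.one_sub_sq_div_two_le_cos (x := ω)
    have h9 : F * (1 - ω ^ 2 / 2) ≤ F * Real.cos ω := by gcongr
    have hω3 : ω ≤ 1 := by nlinarith
    -- `35 = 190 / 2 - 60` is what remains to absorb the curvature term `ω² / 2`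
    have h10 : 0 ≤ F * (ω * (35 * (m : ℝ) ^ 2 - ω / 2)) := by
      have : 0 ≤ 35 * (m : ℝ) ^ 2 - ω / 2 := by linarith
      positivity
    rw [hαe] at h1
    nlinarith
  · have hω0 : 0 < θ - φ := by linarith
    refine conclude (θ - φ) hω0 (by linarith) ?_
    rw [rot] at hact
    have hc0 : 0 ≤ Real.cos (θ - φ) :=
      Real.cos_nonneg_of_neg_pi_div_two_le_of_le (by linarith) (by linarith)
    have h1 : α * Real.cos (θ - φ) ≤ F := by
      have : F * Real.cos (θ - φ) ≤ F * 1 := by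
        gcongr
        exact Real.cos_le_one _
      have := mul_le_mul_of_nonneg_right hαF hc0
      linarith
    have h2 := arcHeight_mul_exp_le m hφ0 hφθ
    have h3 := Real.add_one_le_exp (190 * (m : ℝ) ^ 2 * (θ - φ))
    have h4 : F * (1 + 190 * (m : ℝ) ^ 2 * (θ - φ)) ≤ η * arcHeight m φ := by
      rw [hF, mul_assoc]
      refine mul_le_mul_of_nonneg_left (le_trans ?_ h2) hη
      refine mul_le_mul_of_nonneg_left ?_ (arcHeight_pos m θ).le
      linarith
    have h5 : 0 ≤ F * ((m : ℝ) ^ 2 * (θ - φ)) := by positivity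
    nlinarith

end AngularSpeed

/-! ### Dual vectors of the cone -/

section Dual

variable {H : Type*} [NormedAddCommGroup H] [InnerProductSpace ℝ H] {e : ℕ → H}

theorem dual_feasible {q : H} (hq : ∀ k ∈ coneK e, ⟪q, k⟫_ℝ ≤ 0) (m : ℕ) {φ : ℝ} (h0 : 0 ≤ φ)
    (h1 : φ ≤ Real.pi / 2) :
    ⟪q, e (m + 1)⟫_ℝ * Real.cos φ + ⟪q, e (m + 2)⟫_ℝ * Real.sin φ ≤
      -⟪q, e 0⟫_ℝ * arcHeight m φ := by
  have h := hq _ (arc_mem_coneK e m h0 h1)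
  simp only [inner_add_right, inner_smul_right] at h
  linarith

/-- If `q` lies in the polar cone of `K`, it stays there when its coordinates `1, …, m` are
replaced by `0` and the coordinates `m + 1` and `m + 2` by a pair `(A, C)` that is feasible on the
arc number `m`, provided that the coordinate `m + 2` does not increase. Hence such a replacement
cannot make the inner product with a point of the cone that is orthogonal to `q` positive. -/
theorem dual_replacement (he : Orthonormal ℝ e) {q z : H} (hz : z ∈ coneK e)
    (hqz : ⟪q, z⟫_ℝ = 0) (hq : ∀ k ∈ coneK e, ⟪q, k⟫_ℝ ≤ 0) (hq0 : ⟪q, e 0⟫_ℝ ≤ 0)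
    (m : ℕ) {A C : ℝ}
    (hAC : ∀ φ, 0 ≤ φ → φ ≤ Real.pi / 2 →
      A * Real.cos φ + C * Real.sin φ ≤ -⟪q, e 0⟫_ℝ * arcHeight m φ)
    (hC : C ≤ ⟪q, e (m + 2)⟫_ℝ) :
    (A - ⟪q, e (m + 1)⟫_ℝ) * ⟪e (m + 1), z⟫_ℝ + (C - ⟪q, e (m + 2)⟫_ℝ) * ⟪e (m + 2), z⟫_ℝ ≤
      ∑ j ∈ Finset.range m, ⟪q, e (j + 1)⟫_ℝ * ⟪e (j + 1), z⟫_ℝ := by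
  set q' : H := q - ∑ j ∈ Finset.range m, ⟪q, e (j + 1)⟫_ℝ • e (j + 1) +
    (A - ⟪q, e (m + 1)⟫_ℝ) • e (m + 1) + (C - ⟪q, e (m + 2)⟫_ℝ) • e (m + 2) with hq'
  have hin : ∀ i, ⟪q', e i⟫_ℝ = ⟪q, e i⟫_ℝ -
      (∑ j ∈ Finset.range m, ⟪q, e (j + 1)⟫_ℝ * if j + 1 = i then 1 else 0) +
      ((A - ⟪q, e (m + 1)⟫_ℝ) * if m + 1 = i then 1 else 0) +
      ((C - ⟪q, e (m + 2)⟫_ℝ) * if m + 2 = i then 1 else 0) := fun i => by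
    simp only [hq', inner_add_left, inner_sub_left, sum_inner, real_inner_smul_left,
      inner_basis he]
  have hzero : ⟪q', e 0⟫_ℝ = ⟪q, e 0⟫_ℝ := by
    rw [hin]
    simp
  have hlow : ∀ i < m, ⟪q', e (i + 1)⟫_ℝ = 0 := fun i hi => by
    rw [hin]
    simp [hi, show m ≠ i by omega, show m + 1 ≠ i by omega]
  have hm1 : ⟪q', e (m + 1)⟫_ℝ = A := by
    rw [hin]
    simp
  have hm2 : ⟪q', e (m + 2)⟫_ℝ = C := by
    rw [hin]
    simp
  have hhigh : ∀ i, m + 3 ≤ i → ⟪q', e i⟫_ℝ = ⟪q, e i⟫_ℝ := fun i hi => by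
    rw [hin, Finset.sum_eq_zero fun j hj => ?_]
    · simp [show m + 1 ≠ i by omega, show m + 2 ≠ i by omega]
    · have := Finset.mem_range.1 hj
      simp [show j + 1 ≠ i by omega]
  have hle : ⟪q', z⟫_ℝ ≤ 0 := by
    refine inner_le_zero_of_mem_coneK (fun k φ h0 h1 => ?_) hz
    have hs := Real.sin_nonneg_of_nonneg_of_le_pi h0 (by linarith [Real.pi_pos])
    have hc := Real.cos_nonneg_of_neg_pi_div_two_le_of_le (by linarith [Real.pi_pos]) h1
    have ha := (arcHeight_pos k φ).le
    have hη : 0 ≤ -⟪q, e 0⟫_ℝ := by linarith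
    rw [hzero]
    have hf := dual_feasible hq k h0 h1
    rcases lt_trichotomy k m with hk | rfl | hk
    · rw [hlow k hk]
      rcases eq_or_ne (k + 1) m with rfl | hne
      · rw [show k + 2 = k + 1 + 1 from rfl, hm1]
        have hA := hAC 0 le_rfl (by positivity)
        rw [Real.cos_zero, Real.sin_zero] at hA
        have h2 : -⟪q, e 0⟫_ℝ * arcHeight (k + 1) 0 ≤ -⟪q, e 0⟫_ℝ * arcHeight k φ :=
          mul_le_mul_of_nonneg_left (arcHeight_zero_succ_le k h0 h1) hη
        have h3 : Real.sin φ * A ≤ Real.sin φ * (-⟪q, e 0⟫_ℝ * arcHeight k φ) :=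
          mul_le_mul_of_nonneg_left (by linarith) hs
        have h4 := mul_le_of_le_one_left (mul_nonneg hη ha) (Real.sin_le_one φ)
        linarith
      · rw [hlow (k + 1) (by omega)]
        have := mul_nonneg hη ha
        linarith
    · rw [hm1, hm2]
      have := hAC φ h0 h1
      linarith
    · rcases eq_or_ne k (m + 1) with rfl | hne
      · rw [show m + 1 + 1 = m + 2 from rfl, hm2, hhigh _ (by omega)]
        have := mul_le_mul_of_nonneg_right hC hc
        rw [show m + 1 + 1 = m + 2 from rfl] at hf
        linarith
      · rw [hhigh _ (by omega), hhigh _ (by omega)]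
        linarith
  simp only [hq', inner_add_left, inner_sub_left, sum_inner, real_inner_smul_left, hqz] at hle
  linarith

/-- Projecting onto the cone does not reactivate leading coordinates that vanish. -/
theorem inner_eq_zero_of_proj (he : Orthonormal ℝ e) {x z : H} (hz : z ∈ coneK e)
    (hqz : ⟪x - z, z⟫_ℝ = 0) (hq : ∀ k ∈ coneK e, ⟪x - z, k⟫_ℝ ≤ 0) (hx0 : ⟪e 0, x⟫_ℝ = 0)
    {m : ℕ} (hx : ∀ j < m, ⟪e (j + 1), x⟫_ℝ = 0) : ∀ j < m, ⟪e (j + 1), z⟫_ℝ = 0 := by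
  have hq0 : ⟪x - z, e 0⟫_ℝ ≤ 0 := by
    rw [real_inner_comm, inner_sub_right, hx0]
    linarith [inner_nonneg_of_mem_coneK he 0 hz]
  have h := dual_replacement he hz hqz hq hq0 m (fun φ h0 h1 => dual_feasible hq m h0 h1) le_rfl
  have hsum : ∑ j ∈ Finset.range m, ⟪x - z, e (j + 1)⟫_ℝ * ⟪e (j + 1), z⟫_ℝ =
      -∑ j ∈ Finset.range m, ⟪e (j + 1), z⟫_ℝ ^ 2 := by
    rw [← Finset.sum_neg_distrib]
    refine Finset.sum_congr rfl fun j hj => ?_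
    rw [real_inner_comm, inner_sub_right, hx j (Finset.mem_range.1 hj)]
    ring
  rw [hsum, sub_self, sub_self, zero_mul, zero_mul, add_zero] at h
  have h0 : ∑ j ∈ Finset.range m, ⟪e (j + 1), z⟫_ℝ ^ 2 = 0 :=
    le_antisymm (by linarith) (Finset.sum_nonneg fun _ _ => sq_nonneg _)
  intro j hj
  have := (Finset.sum_eq_zero_iff_of_nonneg fun _ _ => sq_nonneg _).1 h0 j (Finset.mem_range.2 hj)
  exact pow_eq_zero_iff (two_ne_zero) |>.1 this

end Dual

/-! ### Distance to the cone -/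

section Distance

variable {H : Type*} [NormedAddCommGroup H] [InnerProductSpace ℝ H]

/-- Lifting each coordinate `e (i + 1)` of `x` to the point of the curve with parameter `i` gives
a point of the cone above `x`. -/
theorem exists_add_smul_mem_coneK (e : HilbertBasis ℕ ℝ H) {x : H} (hx0 : ⟪e 0, x⟫_ℝ = 0)
    (hx1 : ‖x‖ ≤ 1) (hpos : ∀ i, 0 ≤ ⟪e i, x⟫_ℝ) {m : ℕ} (hm : 1 ≤ m)
    (hx : ∀ j < m, ⟪e (j + 1), x⟫_ℝ = 0) :
    ∃ t : ℝ, 0 ≤ t ∧ t ≤ 1 / (200 * (m : ℝ) ^ 2) ∧ x + t • e 0 ∈ coneK e := by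
  have hm' : (1 : ℝ) ≤ m := by exact_mod_cast hm
  -- the truncated `0 - 1` is harmless, because the coordinate `0` of `x` vanishes
  set g : ℕ → ℝ := fun i => ⟪e i, x⟫_ℝ * arcHeight (i - 1) 0 with hg
  have hg0 : ∀ i, 0 ≤ g i := fun i => mul_nonneg (hpos i) (arcHeight_pos _ _).le
  have hgle : ∀ i, g i ≤ 1 / (400 * (m : ℝ) ^ 2) * (1 / 2) ^ i := fun i => by
    rcases i with _ | i
    · simp only [hg, hx0, zero_mul]
      positivity
    · rcases lt_or_ge i m with hi | hi
      · simp only [hg, hx i hi, zero_mul]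
        positivity
      · have hi1 : 1 ≤ i := hm.trans hi
        have hmi : (m : ℝ) ≤ i := by exact_mod_cast hi
        have h1 := arcHeight_zero_mul_le hi1
        have h2 : ⟪e (i + 1), x⟫_ℝ ≤ 1 := by
          have := real_inner_le_norm (e (i + 1)) x
          rw [e.orthonormal.1, one_mul] at this
          linarith
        simp only [hg, Nat.add_sub_cancel]
        have h3 : arcHeight i 0 ≤ 1 / (400 * (m : ℝ) ^ 2) * (1 / 2) ^ (i + 1) := by
          have e1 : 1 / (400 * (m : ℝ) ^ 2) * (1 / 2) ^ (i + 1) =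
              1 / (2 ^ (i + 1) * (400 * (m : ℝ) ^ 2)) := by
            rw [one_div_pow, ← one_div_mul_one_div]
            ring
          rw [e1, le_div_iff₀ (by positivity)]
          refine le_trans ?_ h1
          have := (arcHeight_pos i 0).le
          gcongr
        calc ⟪e (i + 1), x⟫_ℝ * arcHeight i 0 ≤ 1 * arcHeight i 0 :=
              mul_le_mul_of_nonneg_right h2 (arcHeight_pos i 0).le
          _ ≤ _ := by rwa [one_mul]
  have hgeo : Summable fun i : ℕ => 1 / (400 * (m : ℝ) ^ 2) * (1 / 2 : ℝ) ^ i :=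
    summable_geometric_two.mul_left _
  have hgs : Summable g := Summable.of_nonneg_of_le hg0 hgle hgeo
  refine ⟨∑' i, g i, tsum_nonneg hg0, ?_, ?_⟩
  · refine (hgs.tsum_le_tsum hgle hgeo).trans ?_
    rw [tsum_mul_left, tsum_geometric_two]
    apply le_of_eq
    field_simp
    norm_num
  · have hs : HasSum (fun i => ⟪e i, x⟫_ℝ • e i + g i • e 0) (x + (∑' i, g i) • e 0) := by
      refine HasSum.add ?_ (hgs.hasSum.smul_const _)
      simpa only [HilbertBasis.repr_apply_apply] using e.hasSum_repr x
    refine (isClosed_coneK e).mem_of_tendsto hs (Eventually.of_forall fun s => ?_)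
    refine Finset.sum_induction _ (· ∈ coneK e) (fun _ _ ha hb => (coneK e).add_mem ha hb)
      (zero_mem_coneK e) fun i _ => ?_
    rcases i with _ | i
    · simp only [hg, hx0, zero_mul, zero_smul, add_zero]
      exact zero_mem_coneK e
    · have h := smul_mem_coneK (hpos (i + 1))
        (arc_mem_coneK e i le_rfl (by positivity : (0 : ℝ) ≤ Real.pi / 2))
      rw [Real.cos_zero, Real.sin_zero, zero_smul, add_zero, one_smul, smul_add, smul_smul,
        add_comm] at h
      exact h

end Distance

/-! ### The norm stays away from zero -/

section Invariant

/-- A displacement with small tangential component `N sin δ` and radial component at most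
`N sin δ / (60 m²)` loses at most `δ / (30 m²)` of the radius; half of this is the allowance for the
curvature term `N (1 - cos δ)`. -/
theorem radial_loss_le {m : ℕ} (hm : 1 ≤ m) {N N' F δ t : ℝ} (hN2 : 1 / 2 ≤ N) (hN1 : N ≤ 1)
    (hδ0 : 0 ≤ δ) (hδ1 : δ ≤ Real.pi / 2) (ht : t ≤ 1 / (200 * (m : ℝ) ^ 2))
    (hsin : N * Real.sin δ ≤ 2 * t) (htan : 60 * (m : ℝ) ^ 2 * F ≤ N * Real.sin δ)
    (hrad : N * Real.cos δ - N' ≤ F) : N - N' ≤ δ / (30 * (m : ℝ) ^ 2) := by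
  have hm' : (1 : ℝ) ≤ m := by exact_mod_cast hm
  have hπ := Real.pi_pos
  have hπ2 := Real.pi_lt_d2
  set r := 1 / (m : ℝ) ^ 2 with hr
  have hr0 : 0 ≤ r := by positivity
  have hmr : (m : ℝ) ^ 2 * r = 1 := by
    rw [hr]
    field_simp
  have htr : t ≤ r / 200 := by
    refine ht.trans (le_of_eq ?_)
    rw [hr]
    field_simp
  have hs0 : 0 ≤ Real.sin δ := Real.sin_nonneg_of_nonneg_of_le_pi hδ0 (by linarith)
  have hδr : δ ≤ r / 30 := by
    have g1 := Real.mul_le_sin hδ0 hδ1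
    have g2 : δ ≤ Real.pi / 2 * Real.sin δ := by
      rw [div_mul_eq_mul_div, div_le_iff₀ hπ] at g1
      linarith
    have g3 := mul_le_mul_of_nonneg_right hN2 hs0
    have g4 := mul_le_mul_of_nonneg_right (show Real.pi / 2 ≤ 1.575 by linarith) hs0
    linarith
  have hFr : F ≤ N * δ * r / 60 := by
    have g1 : N * Real.sin δ ≤ N * δ :=
      mul_le_mul_of_nonneg_left (Real.sin_le hδ0) (by linarith)
    have g2 := mul_le_mul_of_nonneg_right (htan.trans g1) hr0
    have g3 : 60 * (m : ℝ) ^ 2 * F * r = 60 * F := by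
      linear_combination 60 * F * hmr
    linarith
  have hcos : N * (1 - δ ^ 2 / 2) ≤ N * Real.cos δ :=
    mul_le_mul_of_nonneg_left Real.one_sub_sq_div_two_le_cos (by linarith)
  have hδδ : N * (δ * δ) ≤ N * (δ * (r / 30)) := by gcongr
  have hNδ : N * (δ * r) ≤ 1 * (δ * r) := by gcongr
  have e3 : δ / (30 * (m : ℝ) ^ 2) = δ * r / 30 := by
    rw [hr]
    field_simp
  rw [e3]
  linarith

variable {H : Type*} [NormedAddCommGroup H] [InnerProductSpace ℝ H]

/-- The coordinates `1, …, m` of `x` vanish, the next two are `N (cos θ, sin θ)` with `θ` in the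
first quadrant, and the loss `1 - N` is within the budget `θ / (30 m²) + (1 - 1 / m) / 4`: the
second summand pays for the arcs that have been passed, the first one for the angle `θ` covered on
the present arc. -/
structure IsNearCurve (e : ℕ → H) (x : H) (m : ℕ) (N θ : ℝ) : Prop where
  one_le : 1 ≤ m
  inner_eq_zero : ∀ j < m, ⟪e (j + 1), x⟫_ℝ = 0
  nonneg : 0 ≤ θ
  le_pi_div_two : θ ≤ Real.pi / 2
  inner_left : ⟪e (m + 1), x⟫_ℝ = N * Real.cos θ
  inner_right : ⟪e (m + 2), x⟫_ℝ = N * Real.sin θ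
  budget : 1 ≤ N + θ / (30 * (m : ℝ) ^ 2) + (1 - 1 / (m : ℝ)) / 4

theorem IsNearCurve.half_le {e : ℕ → H} {x : H} {m : ℕ} {N θ : ℝ} (h : IsNearCurve e x m N θ) :
    1 / 2 ≤ N := by
  have hm : (1 : ℝ) ≤ m := by exact_mod_cast h.one_le
  have h1 : θ / (30 * (m : ℝ) ^ 2) ≤ 1.6 / 30 := by
    have := h.le_pi_div_two
    have := Real.pi_lt_d2
    have : (1 : ℝ) ≤ (m : ℝ) ^ 2 := one_le_pow₀ hm
    gcongr <;> linarith
  have h2 : 0 ≤ 1 / (m : ℝ) := by positivity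
  have := h.budget
  linarith

theorem IsNearCurve.le_norm {e : ℕ → H} (he : Orthonormal ℝ e) {x : H} {m : ℕ} {N θ : ℝ}
    (h : IsNearCurve e x m N θ) : N ≤ ‖x‖ := by
  have h1 : ⟪Real.cos θ • e (m + 1) + Real.sin θ • e (m + 2), x⟫_ℝ = N := by
    rw [inner_add_left, real_inner_smul_left, real_inner_smul_left, h.inner_left, h.inner_right]
    linear_combination N * Real.sin_sq_add_cos_sq θ
  have h2 : ‖Real.cos θ • e (m + 1) + Real.sin θ • e (m + 2)‖ = 1 := by
    rw [norm_eq_sqrt_real_inner]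
    simp only [inner_add_left, inner_add_right, real_inner_smul_left, inner_smul_right,
      inner_basis he]
    rw [Real.sqrt_eq_one]
    simp only [if_true, show m + 1 ≠ m + 2 by omega, show m + 2 ≠ m + 1 by omega, if_false]
    linear_combination Real.sin_sq_add_cos_sq θ
  have h3 := real_inner_le_norm (Real.cos θ • e (m + 1) + Real.sin θ • e (m + 2)) x
  rwa [h1, h2, one_mul] at h3

variable [CompleteSpace H]

/-- One projection step keeps the iterate near the curve. Let `q` be the residual and
`δ = θ' - θ` the change of angle. The residual has radial component `N cos δ - N'` and tangential
component `N sin δ` at the angle `θ'`. By `tangential_component_ge` the former is at most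
`1 / (60 m²)` times the latter, and `δ` is tiny because `x` is close to `K`; so
`N - N' ≤ δ / (30 m²)`. When the coordinate `m + 1` becomes zero, the next arc starts, and the radial
loss is at most the height of the curve. -/
theorem IsNearCurve.exists_projOnto (e : HilbertBasis ℕ ℝ H) {x : H} (hx0 : ⟪e 0, x⟫_ℝ = 0)
    (hx1 : ‖x‖ ≤ 1) (hpos : ∀ i, 0 ≤ ⟪e i, x⟫_ℝ) {m : ℕ} {N θ : ℝ}
    (h : IsNearCurve e x m N θ) :
    ∃ (m' : ℕ) (N' θ' : ℝ), IsNearCurve e (projOnto (coneK e : Set H) x) m' N' θ' := by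
  have he := e.orthonormal
  obtain ⟨hz, hqz, hq⟩ := projOnto_cone_spec (coneK_nonempty e) (isClosed_coneK e) x
  have hnear := ((projOnto_eq_iff (coneK_nonempty e) (isClosed_coneK e) (coneK e).convex x _).1
    rfl).2
  set z := projOnto (coneK e : Set H) x
  have hm := h.one_le
  have hm' : (1 : ℝ) ≤ m := by exact_mod_cast hm
  have hM : (1 : ℝ) ≤ (m : ℝ) ^ 2 := one_le_pow₀ hm'
  have hπ := Real.pi_pos
  have hπ2 := Real.pi_lt_d2
  have hN2 := h.half_le
  have hN1 : N ≤ 1 := (h.le_norm he).trans hx1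
  have hlow := inner_eq_zero_of_proj he hz hqz hq hx0 h.inner_eq_zero
  set η := -⟪x - z, e 0⟫_ℝ with hη
  have hη0 : η = ⟪e 0, z⟫_ℝ := by
    rw [hη, real_inner_comm, inner_sub_right, hx0]
    ring
  have hηpos : 0 ≤ η := by
    rw [hη0]
    exact inner_nonneg_of_mem_coneK he 0 hz
  have hW : ∀ i, ⟪x - z, e i⟫_ℝ = ⟪e i, x⟫_ℝ - ⟪e i, z⟫_ℝ := fun i => by
    rw [real_inner_comm, inner_sub_right]
  -- the distance to the cone is small
  obtain ⟨t, ht0, ht1, htK⟩ := exists_add_smul_mem_coneK e hx0 hx1 hpos hm h.inner_eq_zero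
  have hdist : ‖x - z‖ ≤ t := by
    refine (hnear _ htK).trans (le_of_eq ?_)
    rw [sub_add_cancel_left, norm_neg, norm_smul, he.1, mul_one, Real.norm_of_nonneg ht0]
  have hηt : η ≤ t := by
    have h1 := (abs_le.1 (abs_real_inner_le_norm (x - z) (e 0))).1
    rw [he.1, mul_one] at h1
    linarith
  have ht2 : t ≤ 1 := by
    refine ht1.trans ?_
    rw [div_le_one (by positivity)]
    linarith
  have hfeas : ∀ φ, 0 ≤ φ → φ ≤ Real.pi / 2 →
      ⟪x - z, e (m + 1)⟫_ℝ * Real.cos φ + ⟪x - z, e (m + 2)⟫_ℝ * Real.sin φ ≤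
        η * arcHeight m φ := fun φ h0 h1 => dual_feasible hq m h0 h1
  have hopt : ∀ A C : ℝ, (∀ φ, 0 ≤ φ → φ ≤ Real.pi / 2 →
      A * Real.cos φ + C * Real.sin φ ≤ η * arcHeight m φ) → C ≤ ⟪x - z, e (m + 2)⟫_ℝ →
      (A - ⟪x - z, e (m + 1)⟫_ℝ) * ⟪e (m + 1), z⟫_ℝ +
        (C - ⟪x - z, e (m + 2)⟫_ℝ) * ⟪e (m + 2), z⟫_ℝ ≤ 0 := fun A C hAC hC => by
    refine (dual_replacement he hz hqz hq (by linarith) m hAC hC).trans (le_of_eq ?_)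
    refine Finset.sum_eq_zero fun j hj => ?_
    rw [hlow j (Finset.mem_range.1 hj), mul_zero]
  have ha := inner_nonneg_of_mem_coneK he (m + 1) hz
  have hc := inner_nonneg_of_mem_coneK he (m + 2) hz
  rcases ha.eq_or_lt with ha | ha
  · obtain ⟨N', θ', hN', hθ0, hθ1, e1, e2⟩ :=
      exists_polar hc (inner_nonneg_of_mem_coneK he (m + 3) hz)
    refine ⟨m + 1, N', θ', by omega, fun j hj => ?_, hθ0, hθ1, e1, e2, ?_⟩
    · rcases Nat.lt_succ_iff_lt_or_eq.1 hj with hj | rfl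
      · exact hlow j hj
      · exact ha.symm
    · have h1 := hfeas θ h.nonneg h.le_pi_div_two
      rw [hW, hW, h.inner_left, h.inner_right, ← ha] at h1
      have h2 : (N * Real.cos θ - 0) * Real.cos θ +
          (N * Real.sin θ - ⟪e (m + 2), z⟫_ℝ) * Real.sin θ =
          N - ⟪e (m + 2), z⟫_ℝ * Real.sin θ := by
        linear_combination N * Real.sin_sq_add_cos_sq θ
      have h3 : ⟪e (m + 2), z⟫_ℝ * Real.sin θ ≤ ⟪e (m + 2), z⟫_ℝ :=
        mul_le_of_le_one_right hc (Real.sin_le_one θ)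
      have h4 : ⟪e (m + 2), z⟫_ℝ ≤ N' := by
        rw [e1]
        exact mul_le_of_le_one_right hN' (Real.cos_le_one θ')
      have h5 : η * arcHeight m θ ≤ 1 / (400 * (m : ℝ) ^ 2) := by
        have g1 : arcHeight m θ ≤ 1 / (400 * (m : ℝ) ^ 2) := by
          refine (arcHeight_le m le_rfl h.nonneg).trans ?_
          rw [le_div_iff₀ (by positivity)]
          refine le_trans ?_ (arcHeight_zero_mul_le hm)
          have := (arcHeight_pos m 0).le
          refine mul_le_mul_of_nonneg_left ?_ this
          exact le_mul_of_one_le_left (by positivity) (one_le_pow₀ (by norm_num))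
        exact (mul_le_of_le_one_left (arcHeight_pos m θ).le (hηt.trans ht2)).trans g1
      have h6 : θ / (30 * (m : ℝ) ^ 2) ≤ 1.6 / (30 * (m : ℝ) ^ 2) := by
        have := h.le_pi_div_two
        gcongr
        linarith
      have h7 : 0 ≤ θ' / (30 * ((m + 1 : ℕ) : ℝ) ^ 2) := by positivity
      have h8 : 1 / (400 * (m : ℝ) ^ 2) + 1.6 / (30 * (m : ℝ) ^ 2) ≤
          (1 / (m : ℝ) - 1 / ((m + 1 : ℕ) : ℝ)) / 4 := by
        have g1 : (1 / (m : ℝ) - 1 / ((m + 1 : ℕ) : ℝ)) / 4 = 1 / (4 * (m * (m + 1))) := by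
          push_cast
          field_simp
          ring
        have g2 : 1 / (400 * (m : ℝ) ^ 2) + 1.6 / (30 * (m : ℝ) ^ 2) ≤ 1 / (8 * (m : ℝ) ^ 2) := by
          have g3 : 1 / (400 * (m : ℝ) ^ 2) + 1.6 / (30 * (m : ℝ) ^ 2) =
              (1 / 400 + 1.6 / 30) * (1 / (m : ℝ) ^ 2) := by
            field_simp
          have g4 : 1 / (8 * (m : ℝ) ^ 2) = 1 / 8 * (1 / (m : ℝ) ^ 2) := by
            field_simp
          rw [g3, g4]
          gcongr
          norm_num
        rw [g1]
        refine g2.trans (one_div_le_one_div_of_le (by positivity) ?_)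
        nlinarith
      have := h.budget
      linarith
  · obtain ⟨N', θ', hN', hθ0, hθ1, e1, e2⟩ := exists_polar ha.le hc
    refine ⟨m, N', θ', hm, hlow, hθ0, hθ1, e1, e2, ?_⟩
    have hN'pos : 0 < N' := by
      rcases hN'.eq_or_lt with h0 | h0
      · rw [e1, ← h0, zero_mul] at ha
        exact absurd ha (lt_irrefl _)
      · exact h0
    have hθ2 : θ' < Real.pi / 2 := by
      rcases hθ1.eq_or_lt with h0 | h0
      · rw [e1, h0, Real.cos_pi_div_two, mul_zero] at ha
        exact absurd ha (lt_irrefl _)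
      · exact h0
    rw [e1, e2] at hopt
    have htan := tangential_component_ge hm hηpos hN'pos hθ0 hθ2 hfeas hopt
    have hrad := hfeas θ' hθ0 hθ1
    set F := η * arcHeight m θ'
    set δ := θ' - θ with hδ
    have eβ : ⟪x - z, e (m + 1)⟫_ℝ * Real.sin θ' - ⟪x - z, e (m + 2)⟫_ℝ * Real.cos θ' =
        N * Real.sin δ := by
      rw [hW, hW, h.inner_left, h.inner_right, e1, e2, hδ, Real.sin_sub]
      ring
    have eα : ⟪x - z, e (m + 1)⟫_ℝ * Real.cos θ' + ⟪x - z, e (m + 2)⟫_ℝ * Real.sin θ' =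
        N * Real.cos δ - N' := by
      rw [hW, hW, h.inner_left, h.inner_right, e1, e2, hδ, Real.cos_sub]
      linear_combination (-N') * Real.sin_sq_add_cos_sq θ'
    have hβt : N * Real.sin δ ≤ 2 * t := by
      have g1 := (abs_le.1 (abs_real_inner_le_norm (x - z) (e (m + 1))))
      have g2 := (abs_le.1 (abs_real_inner_le_norm (x - z) (e (m + 2))))
      rw [he.1, mul_one] at g1 g2
      have s0 := Real.sin_nonneg_of_nonneg_of_le_pi hθ0 (by linarith)
      have c0 := Real.cos_nonneg_of_neg_pi_div_two_le_of_le (by linarith) hθ1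
      have s1 := Real.sin_le_one θ'
      have c1 := Real.cos_le_one θ'
      rw [← eβ]
      nlinarith
    rw [eβ] at htan
    rw [eα] at hrad
    have hF0 : 0 ≤ F := mul_nonneg hηpos (arcHeight_pos m θ').le
    have hsin0 : 0 ≤ Real.sin δ := by
      have : 0 ≤ N * Real.sin δ := le_trans (by positivity) htan
      exact nonneg_of_mul_nonneg_right this (by linarith)
    have hθb := h.le_pi_div_two
    have hθa := h.nonneg
    have hδ0 : 0 ≤ δ := by
      by_contra! hneg
      exact absurd (Real.sin_neg_of_neg_of_neg_pi_lt hneg (by linarith)) (not_lt.2 hsin0)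
    have hloss := radial_loss_le hm hN2 hN1 hδ0 (by linarith) ht1 hβt htan hrad
    have hb := h.budget
    have e4 : θ' / (30 * (m : ℝ) ^ 2) = θ / (30 * (m : ℝ) ^ 2) + δ / (30 * (m : ℝ) ^ 2) := by
      rw [hδ]
      ring
    linarith

end Invariant

/-! ### The alternating projection sequence -/

section Sequence

variable {H : Type*} [NormedAddCommGroup H] [InnerProductSpace ℝ H]
  (e : HilbertBasis ℕ ℝ H)

theorem starProjection_hyperplaneV (x : H) :
    (hyperplaneV e).starProjection x = x - ⟪e 0, x⟫_ℝ • e 0 := by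
  rw [Submodule.starProjection_orthogonal_val,
    Submodule.starProjection_unit_singleton ℝ (e.orthonormal.1 0)]

theorem inner_zero_starProjection_hyperplaneV (x : H) :
    ⟪e 0, (hyperplaneV e).starProjection x⟫_ℝ = 0 := by
  rw [starProjection_hyperplaneV, inner_sub_right, inner_smul_right, inner_basis e.orthonormal]
  simp

theorem inner_succ_starProjection_hyperplaneV (i : ℕ) (x : H) :
    ⟪e (i + 1), (hyperplaneV e).starProjection x⟫_ℝ = ⟪e (i + 1), x⟫_ℝ := by
  rw [starProjection_hyperplaneV, inner_sub_right, inner_smul_right, inner_basis e.orthonormal]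
  simp

theorem basis_mem_hyperplaneV {i : ℕ} (hi : i ≠ 0) : e i ∈ hyperplaneV e := by
  rw [Submodule.mem_orthogonal_singleton_iff_inner_right, inner_basis e.orthonormal]
  simp [hi.symm]

/-- The shadow `proj_V z_n` of the sequence of alternating projections started at `e 2`. -/
noncomputable def shadow (n : ℕ) : H :=
  (hyperplaneV e).starProjection
    (alternatingProj (hyperplaneV e) (coneK e : Set H) (e 2) n)

theorem shadow_zero : shadow e 0 = e 2 :=
  Submodule.starProjection_eq_self_iff.2 (basis_mem_hyperplaneV e two_ne_zero)

theorem shadow_succ (n : ℕ) :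
    shadow e (n + 1) =
      (hyperplaneV e).starProjection (projOnto (coneK e : Set H) (shadow e n)) :=
  rfl

theorem shadow_mem (n : ℕ) : shadow e n ∈ hyperplaneV e :=
  Submodule.starProjection_apply_mem _ _

theorem inner_zero_shadow (n : ℕ) : ⟪e 0, shadow e n⟫_ℝ = 0 :=
  inner_zero_starProjection_hyperplaneV e _

variable [CompleteSpace H]

theorem inner_shadow_nonneg (n i : ℕ) : 0 ≤ ⟪e i, shadow e n⟫_ℝ := by
  rcases i with _ | i
  · exact (inner_zero_shadow e n).ge
  · rcases n with _ | n
    · rw [shadow_zero, inner_basis e.orthonormal]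
      split_ifs <;> norm_num
    · rw [shadow_succ, inner_succ_starProjection_hyperplaneV]
      exact inner_nonneg_of_mem_coneK e.orthonormal _
        (projOnto_cone_spec (coneK_nonempty e) (isClosed_coneK e) _).1

theorem norm_sq_shadow_succ_add_le (n : ℕ) :
    ‖shadow e (n + 1)‖ ^ 2 + ⟪e 0, projOnto (coneK e : Set H) (shadow e n)⟫_ℝ ^ 2 ≤
      ‖shadow e n‖ ^ 2 := by
  obtain ⟨-, h, -⟩ := projOnto_cone_spec (coneK_nonempty e) (isClosed_coneK e) (shadow e n)
  rw [shadow_succ, starProjection_hyperplaneV]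
  set z := projOnto (coneK e : Set H) (shadow e n)
  set x := shadow e n
  have h1 : ‖x‖ ^ 2 = ‖x - z‖ ^ 2 + ‖z‖ ^ 2 := by
    have := norm_add_sq_real (x - z) z
    rw [sub_add_cancel, h] at this
    linarith
  have h2 : ‖z - ⟪e 0, z⟫_ℝ • e 0‖ ^ 2 + ⟪e 0, z⟫_ℝ ^ 2 = ‖z‖ ^ 2 := by
    rw [norm_sub_sq_real, inner_smul_right, norm_smul, e.orthonormal.1, real_inner_comm, mul_one,
      Real.norm_eq_abs, sq_abs]
    ring
  linarith [sq_nonneg ‖x - z‖]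

theorem norm_shadow_le_one (n : ℕ) : ‖shadow e n‖ ≤ 1 := by
  induction n with
  | zero => rw [shadow_zero, e.orthonormal.1]
  | succ n ih =>
    refine le_trans (le_of_sq_le_sq ?_ (norm_nonneg _)) ih
    linarith [norm_sq_shadow_succ_add_le e n,
      sq_nonneg ⟪e 0, projOnto (coneK e : Set H) (shadow e n)⟫_ℝ]

theorem exists_isNearCurve_shadow (n : ℕ) :
    ∃ (m : ℕ) (N θ : ℝ), IsNearCurve e (shadow e n) m N θ := by
  induction n with
  | zero =>
    refine ⟨1, 1, 0, le_rfl, fun j hj => ?_, le_rfl, by positivity, ?_, ?_, by norm_num⟩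
    · rw [shadow_zero, inner_basis e.orthonormal, if_neg (by omega)]
    · rw [shadow_zero, inner_basis e.orthonormal]
      simp
    · rw [shadow_zero, inner_basis e.orthonormal]
      simp
  | succ n ih =>
    obtain ⟨m, N, θ, h⟩ := ih
    obtain ⟨m', N', θ', h'⟩ := h.exists_projOnto e (inner_zero_shadow e n)
      (norm_shadow_le_one e n) (inner_shadow_nonneg e n)
    refine ⟨m', N', θ', h'.one_le, fun j hj => ?_, h'.nonneg, h'.le_pi_div_two, ?_, ?_,
      h'.budget⟩
    · rw [shadow_succ, inner_succ_starProjection_hyperplaneV, h'.inner_eq_zero j hj]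
    · rw [shadow_succ, inner_succ_starProjection_hyperplaneV, h'.inner_left]
    · rw [shadow_succ, inner_succ_starProjection_hyperplaneV, h'.inner_right]

theorem half_le_norm_shadow (n : ℕ) : 1 / 2 ≤ ‖shadow e n‖ := by
  obtain ⟨m, N, θ, h⟩ := exists_isNearCurve_shadow e n
  exact h.half_le.trans (h.le_norm e.orthonormal)

/-- The heights are square summable, being bounded by the decrements of the squared norm. -/
theorem tendsto_height :
    Tendsto (fun n => ⟪e 0, projOnto (coneK e : Set H) (shadow e n)⟫_ℝ) atTop (𝓝 0) := by
  have hanti : Antitone fun n => ‖shadow e n‖ ^ 2 := antitone_nat_of_succ_le fun n => by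
    linarith [norm_sq_shadow_succ_add_le e n,
      sq_nonneg ⟪e 0, projOnto (coneK e : Set H) (shadow e n)⟫_ℝ]
  have hlim := tendsto_atTop_ciInf hanti ⟨0, Set.forall_mem_range.2 fun n => sq_nonneg _⟩
  have hdiff := hlim.sub (hlim.comp (tendsto_add_atTop_nat 1))
  rw [sub_self] at hdiff
  have hsq : Tendsto (fun n => ⟪e 0, projOnto (coneK e : Set H) (shadow e n)⟫_ℝ ^ 2) atTop
      (𝓝 0) := by
    refine squeeze_zero (fun n => sq_nonneg _) (fun n => ?_) hdiff
    have := norm_sq_shadow_succ_add_le e n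
    simp only [Function.comp]
    linarith
  have h := hsq.sqrt
  rw [Real.sqrt_zero] at h
  simpa only [Real.sqrt_sq_eq_abs, tendsto_zero_iff_abs_tendsto_zero, Function.comp_def,
    abs_abs] using h

theorem tendsto_inner_basis_shadow (i : ℕ) :
    Tendsto (fun n => ⟪e i, shadow e n⟫_ℝ) atTop (𝓝 0) := by
  rcases i with _ | i
  · simp only [inner_zero_shadow]
    exact tendsto_const_nhds
  · rw [← tendsto_add_atTop_iff_nat 1]
    have h := (tendsto_height e).div_const (arcHeight (i + 1) 0)
    rw [zero_div] at h
    refine squeeze_zero (fun n => inner_shadow_nonneg e _ _) (fun n => ?_) h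
    rw [le_div_iff₀ (arcHeight_pos _ _), shadow_succ, inner_succ_starProjection_hyperplaneV]
    exact inner_mul_le_of_mem_coneK e.orthonormal i
      (projOnto_cone_spec (coneK_nonempty e) (isClosed_coneK e) _).1

theorem tendsto_inner_shadow (w : H) :
    Tendsto (fun n => ⟪w, shadow e n⟫_ℝ) atTop (𝓝 0) := by
  have hspan : ∀ v ∈ Submodule.span ℝ (Set.range e),
      Tendsto (fun n => ⟪v, shadow e n⟫_ℝ) atTop (𝓝 0) := by
    intro v hv
    induction hv using Submodule.span_induction with
    | mem x hx =>
      obtain ⟨i, rfl⟩ := hx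
      exact tendsto_inner_basis_shadow e i
    | zero => simp
    | add x y _ _ hx hy => simpa only [inner_add_left, add_zero] using hx.add hy
    | smul a x _ hx => simpa only [real_inner_smul_left, mul_zero] using hx.const_mul a
  have hw : w ∈ closure (Submodule.span ℝ (Set.range e) : Set H) := by
    rw [← Submodule.topologicalClosure_coe, e.dense_span]
    trivial
  rw [Metric.tendsto_atTop]
  intro ε hε
  obtain ⟨v, hv, hwv⟩ := Metric.mem_closure_iff.1 hw (ε / 2) (by positivity)
  obtain ⟨n₀, hn₀⟩ := Metric.tendsto_atTop.1 (hspan v hv) (ε / 2) (by positivity)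
  refine ⟨n₀, fun n hn => ?_⟩
  have h1 := hn₀ n hn
  rw [dist_zero_right, Real.norm_eq_abs] at h1 ⊢
  rw [dist_eq_norm] at hwv
  have h2 : |⟪w - v, shadow e n⟫_ℝ| ≤ ‖w - v‖ :=
    (abs_real_inner_le_norm _ _).trans
      (mul_le_of_le_one_right (norm_nonneg _) (norm_shadow_le_one e n))
  have h3 : ⟪w, shadow e n⟫_ℝ = ⟪w - v, shadow e n⟫_ℝ + ⟪v, shadow e n⟫_ℝ := by
    rw [← inner_add_left, sub_add_cancel]
  rw [h3]
  linarith [abs_add_le ⟪w - v, shadow e n⟫_ℝ ⟪v, shadow e n⟫_ℝ]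

theorem tendsto_toWeakSpace_shadow :
    Tendsto (fun n => toWeakSpace ℝ H (shadow e n)) atTop (𝓝 (toWeakSpace ℝ H 0)) := by
  have hind : IsInducing fun (x : WeakSpace ℝ H) (f : StrongDual ℝ H) =>
      (topDualPairing ℝ H).flip x f := ⟨rfl⟩
  rw [hind.tendsto_nhds_iff, tendsto_pi_nhds]
  intro f
  have h := tendsto_inner_shadow e ((InnerProductSpace.toDual ℝ H).symm f)
  simp only [InnerProductSpace.toDual_symm_apply] at h
  change Tendsto (fun n => f (shadow e n)) atTop (𝓝 (f 0))
  rwa [map_zero]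

end Sequence

/-! ### The method of partial inverses -/

section PartialInverse

variable {H : Type*} [NormedAddCommGroup H] [InnerProductSpace ℝ H]

/-- For `B = T⁻¹ - Id` with `T` mapping into `V`, the steps of the method of partial inverses are
`x ↦ T (x + u)` and `u ↦ u`. -/
theorem isPartialInverseSequence_inverseSubId_iff {T : H → H} {V : Submodule ℝ H}
    [V.HasOrthogonalProjection] (hT : ∀ x, T x ∈ V) {x u : ℕ → H} (hx : x 0 ∈ V)
    (hu : u 0 = 0) :
    IsPartialInverseSequence (inverseSubId T) V x u ↔
      ∀ n, u n = 0 ∧ x (n + 1) = T (x n) := by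
  have hproj : ∀ y, V.starProjection (T y) = T y := fun y =>
    Submodule.starProjection_eq_self_iff.2 (hT y)
  constructor
  · intro h
    have hx' : ∀ n, x (n + 1) = T (x n + u n) := fun n => by
      obtain ⟨p, hp, hxp⟩ := h.x_succ n
      rw [mem_resolvent_inverseSubId] at hp
      rw [hxp, ← hp, hproj]
    have hxV : ∀ n, x n ∈ V := fun n => by
      rcases n with _ | n
      · exact hx
      · rw [hx']
        exact hT _
    have hu0 : ∀ n, u n = 0 := fun n => by
      induction n with
      | zero => exact hu
      | succ n ih =>
        obtain ⟨q, hq, hqu⟩ := h.u_succ n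
        rw [mem_resolvent_inverse_inverseSubId, ih, add_zero] at hq
        rw [hqu, ← hq, Submodule.starProjection_orthogonal_val,
          Submodule.starProjection_eq_self_iff.2 (V.sub_mem (hxV n) (hT _)), sub_self]
    exact fun n => ⟨hu0 n, by rw [hx', hu0 n, add_zero]⟩
  · intro h
    have hxV : ∀ n, x n ∈ V := fun n => by
      rcases n with _ | n
      · exact hx
      · rw [(h n).2]
        exact hT _
    refine ⟨hx, hu ▸ Vᗮ.zero_mem, fun n => ?_, fun n => ?_⟩
    · refine ⟨T (x n + u n), (mem_resolvent_inverseSubId _ _ _).2 rfl, ?_⟩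
      rw [hproj, (h n).2, (h n).1, add_zero]
    · refine ⟨_, (mem_resolvent_inverse_inverseSubId _ _ _).2 rfl, ?_⟩
      rw [(h n).1, (h (n + 1)).1, add_zero, Submodule.starProjection_orthogonal_val,
        Submodule.starProjection_eq_self_iff.2 (V.sub_mem (hxV n) (hT _)), sub_self]

end PartialInverse

end Splitting

theorem mainTheorem2 {H : Type*} [NormedAddCommGroup H] [InnerProductSpace ℝ H]
    [CompleteSpace H] (e : HilbertBasis ℕ ℝ H) :
    -- `B` is maximally monotone and the two resolvents are single-valued with full domain
    Splitting.IsMaximallyMonotone (Splitting.operatorB e) ∧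
    (∀ y : H, ∃! p, p ∈ Splitting.resolvent (Splitting.operatorB e) y) ∧
    (∀ y : H, ∃! q, q ∈ Splitting.resolvent (Splitting.inverse (Splitting.operatorB e)) y) ∧
    -- `(0, 0)` solves the problem
    Splitting.IsPartialInverseSolution (Splitting.operatorB e) (Splitting.hyperplaneV e) 0 0 ∧
    -- the method started at `(e 2, 0)` produces a sequence
    (∃ x u : ℕ → H,
      Splitting.IsPartialInverseSequence (Splitting.operatorB e) (Splitting.hyperplaneV e) x u ∧
      x 0 = e 2 ∧ u 0 = 0) ∧
    -- and its sequence has the announced form and converges weakly but not strongly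
    ∀ x u : ℕ → H,
      Splitting.IsPartialInverseSequence (Splitting.operatorB e) (Splitting.hyperplaneV e) x u →
      x 0 = e 2 → u 0 = 0 →
      (∀ n, u n = 0 ∧ x n = (Splitting.hyperplaneV e).starProjection
        (Splitting.alternatingProj (Splitting.hyperplaneV e)
          (Splitting.coneK e : Set H) (e 2) n)) ∧
      Tendsto (fun n => toWeakSpace ℝ (WithLp 2 (H × H)) (WithLp.toLp 2 (x n, u n))) atTop
        (𝓝 (toWeakSpace ℝ (WithLp 2 (H × H)) (WithLp.toLp 2 (0, 0)))) ∧
      ¬ Tendsto (fun n => WithLp.toLp 2 (x n, u n)) atTop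
        (𝓝 (WithLp.toLp 2 ((0, 0) : H × H))) := by
  have hT : Splitting.IsFirmlyNonexpansive fun x =>
      (Splitting.hyperplaneV e).starProjection (Splitting.projOnto (Splitting.coneK e : Set H)
        ((Splitting.hyperplaneV e).starProjection x)) :=
    (Splitting.isFirmlyNonexpansive_projOnto_cone (Splitting.coneK_nonempty e)
      (Splitting.isClosed_coneK e)).starProjection_conj (Splitting.hyperplaneV e)
  have hseq : ∀ x u : ℕ → H, x 0 = e 2 → u 0 = 0 →
      (Splitting.IsPartialInverseSequence (Splitting.operatorB e) (Splitting.hyperplaneV e) x u ↔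
        ∀ n, u n = 0 ∧ x (n + 1) = (Splitting.hyperplaneV e).starProjection
          (Splitting.projOnto (Splitting.coneK e : Set H)
            ((Splitting.hyperplaneV e).starProjection (x n)))) := fun x u hx hu =>
    Splitting.isPartialInverseSequence_inverseSubId_iff
      (fun _ => Submodule.starProjection_apply_mem _ _)
      (hx ▸ Splitting.basis_mem_hyperplaneV e two_ne_zero) hu
  have hproj : ∀ n, (Splitting.hyperplaneV e).starProjection (Splitting.shadow e n) =
      Splitting.shadow e n := fun n =>
    Submodule.starProjection_eq_self_iff.2 (Splitting.shadow_mem e n)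
  refine ⟨hT.isMaximallyMonotone, fun y => ?_, fun y => ?_,
    ⟨Submodule.zero_mem _, Submodule.zero_mem _, ?_⟩, ?_, ?_⟩
  · simp only [Splitting.operatorB, Splitting.mem_resolvent_inverseSubId]
    exact existsUnique_eq'
  · simp only [Splitting.operatorB, Splitting.mem_resolvent_inverse_inverseSubId]
    exact existsUnique_eq'
  · rw [Splitting.operatorB, Splitting.mem_inverseSubId, add_zero, map_zero]
    have h : Splitting.projOnto (Splitting.coneK e : Set H) 0 = 0 := by
      rw [Splitting.projOnto_eq_iff (Splitting.coneK_nonempty e) (Splitting.isClosed_coneK e)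
        (Splitting.coneK e).convex]
      exact ⟨Splitting.zero_mem_coneK e, fun q _ => by simp⟩
    rw [h, map_zero]
  · refine ⟨Splitting.shadow e, fun _ => 0, ?_, Splitting.shadow_zero e, rfl⟩
    rw [hseq _ _ (Splitting.shadow_zero e) rfl]
    exact fun n => ⟨rfl, by rw [hproj, Splitting.shadow_succ]⟩
  · intro x u h hx hu
    rw [hseq x u hx hu] at h
    have hxs : ∀ n, x n = Splitting.shadow e n := fun n => by
      induction n with
      | zero => rw [hx, Splitting.shadow_zero]
      | succ n ih => rw [(h n).2, ih, hproj, Splitting.shadow_succ]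
    have hu0 : ∀ n, u n = 0 := fun n => (h n).1
    refine ⟨fun n => ⟨hu0 n, hxs n⟩, ?_, fun hlim => ?_⟩
    · simp only [hxs, hu0]
      -- pull a functional on the product back to the first factor
      let ι : H →L[ℝ] WithLp 2 (H × H) :=
        (WithLp.prodContinuousLinearEquiv 2 ℝ H H).symm.toContinuousLinearMap.comp
          (ContinuousLinearMap.inl ℝ H H)
      exact ((WeakSpace.map ι).continuous.tendsto _).comp (Splitting.tendsto_toWeakSpace_shadow e)
    · have h1 := hlim.norm
      simp only [hxs, hu0] at h1
      have h2 : ∀ n, 1 / 2 ≤ ‖WithLp.toLp 2 (Splitting.shadow e n, (0 : H))‖ := fun n => by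
        refine (Splitting.half_le_norm_shadow e n).trans ?_
        exact WithLp.norm_fst_le _ (WithLp.toLp 2 (Splitting.shadow e n, (0 : H)))
      have h3 := ge_of_tendsto' h1 h2
      rw [show WithLp.toLp 2 ((0, 0) : H × H) = 0 from rfl, norm_zero] at h3
      norm_num at h3
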